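/- An automorphism $g$ of $(\mathbb{Q},<)$ is called unboundedly increasing if $g(a)>a$ for all $a\in\mathbb{Q}$ and for all $a<b$ in $\mathbb{Q}$ there is $m\in\mathbb{N}$ with $g^m(a)>b$. The random tournament is the (unique up to isomorphism) countable tournament $(\mathbb{T},\to)$ such that for any two disjoint finite sets $A,B\subseteq\mathbb{T}$ there is $x\in\mathbb{T}$ with $x\to a$ for all $a\in A$ and $b\to x$ for all $b\in B$. (1) If $g$ is an unboundedly increasing automorphism of $(\mathbb{Q},<)$, then every element of $\mathrm{Aut}(\mathbb{Q},<)$ is a product of at most eight elements, each of which is a conjugate in $\mathrm{Aut}(\mathbb{Q},<)$ of $g$ or of $g^{-1}$. (2) If $g$ is an automorphism of the random tournament $(\mathbb{T},\to)$ such that $a\to g(a)$ for all $a\in\mathbb{T}$, then every element of $\mathrm{Aut}(\mathbb{T},\to)$ is a product of at most eight elements, each of which is a conjugate in $\mathrm{Aut}(\mathbb{T},\to)$ of $g$ or of $g^{-1}$. -/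

import Mathlib

/-- An automorphism `g` of a linear order is unboundedly increasing if it moves every point
strictly up and, for all `a < b`, some iterate of `g` takes `a` beyond `b`. -/
def UnboundedlyIncreasing {α : Type*} [LinearOrder α] (g : α ≃o α) : Prop :=
  (∀ a, a < g a) ∧ ∀ a b, a < b → ∃ m : ℕ, b < (g ^ m) a

/-- `r` (read `r a b` as `a → b`) is a tournament: it is irreflexive, and between any two
distinct points there is exactly one arrow. -/
structure IsTournament {T : Type*} (r : T → T → Prop) : Prop where
  irrefl : ∀ a, ¬ r a a
  asymm : ∀ a b, r a b → ¬ r b a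
  total : ∀ a b, a ≠ b → r a b ∨ r b a

/-- `(T, r)` is the random tournament: the countable tournament, unique up to isomorphism, in which
for all disjoint finite sets `A`, `B` there is a point `x` with `x → a` for all `a ∈ A` and
`b → x` for all `b ∈ B`. -/
structure IsRandomTournament {T : Type*} (r : T → T → Prop) : Prop extends IsTournament r where
  countable : Countable T
  extension : ∀ A B : Finset T, Disjoint A B → ∃ x, (∀ a ∈ A, r x a) ∧ ∀ b ∈ B, r b x

/-- `h` is a product of at most `n` factors, each a conjugate of `g` or of `g⁻¹`. -/
def IsProdOfConjugates {G : Type*} [Group G] (n : ℕ) (g h : G) : Prop :=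
  ∃ l : List G, l.length ≤ n ∧ (∀ x ∈ l, IsConj g x ∨ IsConj g⁻¹ x) ∧ l.prod = h

/-! Fewer than eight factors suffice: two on the rationals, six on the tournament.

On the rationals, `[0, f 0)` is a fundamental domain for an unboundedly increasing `f`, so `f` is
conjugate to translation by one and all such automorphisms form one conjugacy class. Given `h`, put
`f x = max (h (x + 1)) (x + 1)`. Both `f` and `h⁻¹ * f` dominate the translation, hence lie in this
class, and `h = f * (h⁻¹ * f)⁻¹`.

On the tournament there are two generic constructions from finite partial isomorphisms. The first
(`IsRandomTournament.exists_freelyMoving`) builds `b` so that `u = g * (b * g * b⁻¹)` has only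
infinite orbits and realizes every finite type by some `y → u y` off any finitely many orbits. The
second (`FreelyMoving.exists_conj_mul`) writes any `h` as a product of three conjugates of `u`.
Approximations to the three conjugators are kept so that every determined step of a conjugate lies
on a closed cycle of three steps twisted by `h`. To complete a cycle through `p`, the steps out of
and into `p` are chosen freely on the tournament side. The middle step then has both ends
prescribed: its type constraints are consistent because arrows can be carried around the older
cycles, and `FreelyMoving.dense` realizes it (`LoopTriple.exists_edge_of_mem_of_mem`). -/

/-! ### Finite partial isomorphisms -/

/-- `S` is the graph of a partial isomorphism of `r` (for a tournament `r`, preserving and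
reflecting `r` already forces `S` to be the graph of an injective partial function). -/
def PartIso {T : Type*} (r : T → T → Prop) (S : Set (T × T)) : Prop :=
  ∀ p ∈ S, ∀ q ∈ S, r p.1 q.1 ↔ r p.2 q.2

namespace PartIso

variable {T : Type*} {r : T → T → Prop} {S : Set (T × T)}

theorem empty : PartIso r ∅ := fun _ hp => hp.elim

theorem rel_iff (h : PartIso r S) {x x' y y' : T} (hx : (x, y) ∈ S) (hx' : (x', y') ∈ S) :
    r x x' ↔ r y y' := h _ hx _ hx'

theorem swap (h : PartIso r S) : PartIso r (Prod.swap ⁻¹' S) :=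
  fun _ hp _ hq => (h _ hp _ hq).symm

theorem right_unique (h : PartIso r S) (hr : IsTournament r) {x y y' : T}
    (hy : (x, y) ∈ S) (hy' : (x, y') ∈ S) : y = y' := by
  by_contra hne
  rcases hr.total _ _ hne with h1 | h1
  · exact hr.irrefl _ ((h.rel_iff hy hy').2 h1)
  · exact hr.irrefl _ ((h.rel_iff hy' hy).2 h1)

theorem left_unique (h : PartIso r S) (hr : IsTournament r) {x x' y : T}
    (hx : (x, y) ∈ S) (hx' : (x', y) ∈ S) : x = x' :=
  h.swap.right_unique hr (x := y) hx hx'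

theorem insert (h : PartIso r S) (hr : IsTournament r) {x y : T}
    (hx : x ∉ Prod.fst '' S) (hy : y ∉ Prod.snd '' S)
    (hxy : ∀ q ∈ S, r x q.1 ↔ r y q.2) : PartIso r (insert (x, y) S) := by
  have hyx : ∀ q ∈ S, r q.1 x ↔ r q.2 y := by
    intro q hq
    have h1 : x ≠ q.1 := fun e => hx ⟨q, hq, e.symm⟩
    have h2 : y ≠ q.2 := fun e => hy ⟨q, hq, e.symm⟩
    have := hxy q hq
    constructor
    · intro h3
      exact (hr.total _ _ h2).resolve_left fun h4 => hr.asymm _ _ h3 (this.2 h4)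
    · intro h3
      exact (hr.total _ _ h1).resolve_left fun h4 => hr.asymm _ _ h3 (this.1 h4)
  rintro p (rfl | hp) q (rfl | hq)
  · exact iff_of_false (hr.irrefl _) (hr.irrefl _)
  · exact hxy q hq
  · exact hyx p hp
  · exact h p hp q hq

end PartIso

namespace IsRandomTournament

variable {T : Type*} {r : T → T → Prop} {S : Set (T × T)}

/-- The extension property for finite sets, with the new point outside a given finite set. -/
theorem exists_notMem (hr : IsRandomTournament r) {A B F : Set T} (hA : A.Finite) (hB : B.Finite)
    (hF : F.Finite) (hAB : Disjoint A B) :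
    ∃ x ∉ F, (∀ a ∈ A, r x a) ∧ ∀ b ∈ B, r b x := by
  -- Demanding an arrow from all of `F \ A` to `x` keeps `x` out of `F`, by irreflexivity.
  have hB' : (B ∪ F \ A).Finite := hB.union (hF.subset Set.sdiff_subset)
  have hd : Disjoint hA.toFinset hB'.toFinset := by
    rw [Set.Finite.disjoint_toFinset]
    exact hAB.union_right Set.disjoint_sdiff_right
  obtain ⟨x, hxA, hxB⟩ := hr.extension _ _ hd
  simp only [Set.Finite.mem_toFinset] at hxA hxB
  refine ⟨x, fun hx => ?_, hxA, fun b hb => hxB b (Or.inl hb)⟩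
  by_cases h : x ∈ A
  · exact hr.irrefl x (hxA x h)
  · exact hr.irrefl x (hxB x (Or.inr ⟨hx, h⟩))

/-- One-point extension of a finite partial isomorphism with a prescribed new value `y`: the new
argument can avoid a finite set `F` and be dominated by finitely many points outside the domain. -/
theorem exists_insert_left (hr : IsRandomTournament r) (hS : PartIso r S) (hfin : S.Finite) {y : T}
    (hy : y ∉ Prod.snd '' S) {F C : Set T} (hF : F.Finite) (hC : C.Finite)
    (hCS : Disjoint C (Prod.fst '' S)) :
    ∃ x ∉ F, x ∉ Prod.fst '' S ∧ (∀ c ∈ C, r c x) ∧ PartIso r (insert (x, y) S) := by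
  have hne : ∀ q ∈ S, y ≠ q.2 := fun q hq e => hy ⟨q, hq, e.symm⟩
  have hd : Disjoint (Prod.fst '' {q ∈ S | r y q.2}) (Prod.fst '' {q ∈ S | r q.2 y} ∪ C) := by
    rw [Set.disjoint_left]
    rintro _ ⟨⟨x, z⟩, ⟨h1, h2⟩, rfl⟩ (⟨⟨x', z'⟩, ⟨h3, h4⟩, rfl⟩ | h3)
    · obtain rfl : z = z' := hS.right_unique hr.toIsTournament h1 h3
      exact hr.asymm _ _ h2 h4
    · exact Set.disjoint_left.1 hCS h3 ⟨_, h1, rfl⟩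
  obtain ⟨x, hxF, hxA, hxB⟩ := hr.exists_notMem
    ((hfin.subset (Set.sep_subset _ _)).image _)
    (((hfin.subset (Set.sep_subset _ _)).image _).union hC) (hF.union (hfin.image Prod.fst)) hd
  simp only [Set.mem_union, not_or] at hxF
  refine ⟨x, hxF.1, hxF.2, fun c hc => hxB c (Or.inr hc),
    hS.insert hr.toIsTournament hxF.2 hy fun q hq => ?_⟩
  constructor
  · intro h
    refine (hr.total _ _ (hne q hq)).resolve_right fun h' => ?_
    exact hr.asymm _ _ h (hxB _ (Or.inl ⟨q, ⟨hq, h'⟩, rfl⟩))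
  · intro h
    exact hxA _ ⟨q, ⟨hq, h⟩, rfl⟩

/-- One-point extension of a finite partial isomorphism with a prescribed new argument `x`. -/
theorem exists_insert_right (hr : IsRandomTournament r) (hS : PartIso r S) (hfin : S.Finite) {x : T}
    (hx : x ∉ Prod.fst '' S) {F C : Set T} (hF : F.Finite) (hC : C.Finite)
    (hCS : Disjoint C (Prod.snd '' S)) :
    ∃ y ∉ F, y ∉ Prod.snd '' S ∧ (∀ c ∈ C, r c y) ∧ PartIso r (insert (x, y) S) := by
  have e1 : Prod.snd '' (Prod.swap ⁻¹' S) = Prod.fst '' S := by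
    rw [← Set.image_swap_eq_preimage_swap, Set.image_image]; rfl
  have e2 : Prod.fst '' (Prod.swap ⁻¹' S) = Prod.snd '' S := by
    rw [← Set.image_swap_eq_preimage_swap, Set.image_image]; rfl
  obtain ⟨y, hyF, hyS, hyC, hy⟩ := hr.exists_insert_left hS.swap
    (hfin.preimage Prod.swap_injective.injOn) (e1 ▸ hx) hF hC (e2 ▸ hCS)
  refine ⟨y, hyF, e2 ▸ hyS, hyC, ?_⟩
  have : insert (x, y) S = Prod.swap ⁻¹' (insert (y, x) (Prod.swap ⁻¹' S)) := by
    ext ⟨a, b⟩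
    simp [and_comm]
  exact this ▸ hy.swap

end IsRandomTournament

/-- A total and surjective relation that respects `r` is the graph of an automorphism. -/
theorem IsTournament.exists_relIso {T : Type*} {r : T → T → Prop} (hr : IsTournament r)
    {S : Set (T × T)} (hS : PartIso r S) (hdom : ∀ x, ∃ y, (x, y) ∈ S)
    (hran : ∀ y, ∃ x, (x, y) ∈ S) : ∃ a : r ≃r r, ∀ x y, (x, y) ∈ S → a x = y := by
  choose f hf using hdom
  choose k hk using hran
  refine ⟨⟨⟨f, k, fun x => ?_, fun y => ?_⟩, ?_⟩, fun x y h => ?_⟩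
  · exact hS.left_unique hr (hk _) (hf x)
  · exact hS.right_unique hr (hf _) (hk y)
  · intro x x'
    exact (hS.rel_iff (hf x) (hf x')).symm
  · exact hS.right_unique hr (hf x) h

/-! ### Automorphisms with infinite orbits that move generic points forward -/

/-- `y` lies on none of the `u`-orbits of points of `F`. -/
def OffOrbits {T : Type*} (u : T → T) (F : Set T) (y : T) : Prop :=
  ∀ f ∈ F, ∀ n : ℕ, u^[n] y ≠ f ∧ u^[n] f ≠ y

/-- `u` has only infinite orbits, and every type over a finite set is realized, outside finitely
many given orbits, by a point `y` with `y → u y`. -/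
structure FreelyMoving {T : Type*} {r : T → T → Prop} (u : r ≃r r) : Prop where
  aperiodic : ∀ x (n : ℕ), u^[n] (u x) ≠ x
  dense : ∀ A B F : Set T, A.Finite → B.Finite → F.Finite → Disjoint A B →
    ∃ y, (∀ a ∈ A, r y a) ∧ (∀ b ∈ B, r b y) ∧ r y (u y) ∧ OffOrbits u F y

/-- The part of the conjugate of `u` by the partial map `S` that is already determined. -/
def Edge {T : Type*} (u : T → T) (S : Set (T × T)) (p q : T) : Prop :=
  ∃ y, (p, y) ∈ S ∧ (q, u y) ∈ S

theorem Edge.mono {T : Type*} {u : T → T} {S S' : Set (T × T)} (h : S ⊆ S') {p q : T}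
    (hpq : Edge u S p q) : Edge u S' p q :=
  let ⟨y, h1, h2⟩ := hpq
  ⟨y, h h1, h h2⟩

/-- A finite partial isomorphism whose range meets each `u`-orbit in an interval. -/
structure ConvexPartIso {T : Type*} {r : T → T → Prop} (u : r ≃r r) (S : Set (T × T)) : Prop where
  finite : S.Finite
  partIso : PartIso r S
  convex : ∀ y ∈ Prod.snd '' S, u y ∉ Prod.snd '' S → ∀ n : ℕ, u^[n] (u y) ∉ Prod.snd '' S

section

variable {T : Type*} {r : T → T → Prop} {u : r ≃r r} {S : Set (T × T)}

theorem mem_snd_image {x y : T} (h : (x, y) ∈ S) : y ∈ Prod.snd '' S := ⟨_, h, rfl⟩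

theorem mem_fst_image {x y : T} (h : (x, y) ∈ S) : x ∈ Prod.fst '' S := ⟨_, h, rfl⟩

theorem RelIso.iterate_apply_comm (u : r ≃r r) (n : ℕ) (x : T) : u^[n] (u x) = u (u^[n] x) := by
  rw [← Function.iterate_succ_apply, Function.iterate_succ_apply']

namespace ConvexPartIso

theorem empty : ConvexPartIso u (∅ : Set (T × T)) :=
  ⟨Set.finite_empty, PartIso.empty, by simp⟩

/-- By convexity no later point of the orbit of `y` is in the range, so the interval grows by one
point and no edge leaves `w`. -/
theorem insert_next (hS : ConvexPartIso u S) (hr : IsTournament r) (hu : FreelyMoving u)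
    {p y w : T} (hp : (p, y) ∈ S) (hy : u y ∉ Prod.snd '' S) (hw : PartIso r (insert (w, u y) S)) :
    ConvexPartIso u (insert (w, u y) S) ∧
      ∀ p' q', Edge u (insert (w, u y) S) p' q' → Edge u S p' q' ∨ p' = p ∧ q' = w := by
  have hc := hS.convex y (mem_snd_image hp) hy
  refine ⟨⟨hS.finite.insert _, hw, ?_⟩, ?_⟩
  · rw [Set.image_insert_eq]
    rintro v (rfl | hv) huv n
    · simp only [Set.mem_insert_iff, not_or]
      exact ⟨hu.aperiodic _ n, hc (n + 1)⟩
    · simp only [Set.mem_insert_iff, not_or] at huv ⊢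
      have hcv := hS.convex v hv huv.2
      refine ⟨fun e => ?_, hcv n⟩
      rw [u.iterate_apply_comm] at e
      have e' : u^[n] v = y := u.injective e
      cases n with
      | zero => exact huv.1 (congrArg u e')
      | succ n => exact hcv n (e' ▸ mem_snd_image hp)
  · rintro p' q' ⟨y', h1, h2⟩
    rcases h1 with h1 | h1
    · obtain ⟨rfl, rfl⟩ := Prod.mk.inj h1
      rcases h2 with h2 | h2
      · exact (hu.aperiodic _ 0 (Prod.mk.inj h2).2).elim
      · exact (hc 1 (mem_snd_image h2)).elim
    · rcases h2 with h2 | h2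
      · obtain ⟨rfl, e⟩ := Prod.mk.inj h2
        obtain rfl := u.injective e
        exact Or.inr ⟨hS.partIso.left_unique hr h1 hp, rfl⟩
      · exact Or.inl ⟨y', h1, h2⟩

/-- By convexity no earlier point of the orbit of `v` is in the range, since the gap at `v` would
separate it from `u v`. So no edge enters `w`. -/
theorem insert_prev (hS : ConvexPartIso u S) (hr : IsTournament r) (hu : FreelyMoving u)
    {q v w : T} (hq : (q, u v) ∈ S) (hv : v ∉ Prod.snd '' S) (hw : PartIso r (insert (w, v) S)) :
    ConvexPartIso u (insert (w, v) S) ∧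
      ∀ p' q', Edge u (insert (w, v) S) p' q' → Edge u S p' q' ∨ p' = w ∧ q' = q := by
  have key : ∀ y ∈ Prod.snd '' S, u y ∉ Prod.snd '' S → ∀ n, u^[n] (u y) ≠ v := by
    intro y hy hy' n e
    refine hS.convex y hy hy' (n + 1) ?_
    rw [Function.iterate_succ_apply', e]
    exact mem_snd_image hq
  refine ⟨⟨hS.finite.insert _, hw, ?_⟩, ?_⟩
  · rw [Set.image_insert_eq]
    rintro y (rfl | hy) huy n
    · exact (huy (Or.inr (mem_snd_image hq))).elim
    · simp only [Set.mem_insert_iff, not_or] at huy ⊢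
      exact ⟨key y hy huy.2 n, hS.convex y hy huy.2 n⟩
  · rintro p' q' ⟨y', h1, h2⟩
    rcases h1 with h1 | h1
    · obtain ⟨rfl, rfl⟩ := Prod.mk.inj h1
      rcases h2 with h2 | h2
      · exact (hu.aperiodic _ 0 (Prod.mk.inj h2).2).elim
      · exact Or.inr ⟨rfl, hS.partIso.left_unique hr h2 hq⟩
    · rcases h2 with h2 | h2
      · obtain ⟨rfl, e⟩ := Prod.mk.inj h2
        exact (key y' (mem_snd_image h1) (e ▸ hv) 0 e).elim
      · exact Or.inl ⟨y', h1, h2⟩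

theorem insert_offOrbits (hS : ConvexPartIso u S) (hu : FreelyMoving u) {x y : T}
    (hy : OffOrbits u (Prod.snd '' S) y) (hxy : PartIso r (insert (x, y) S)) :
    ConvexPartIso u (insert (x, y) S) ∧
      ∀ p' q', Edge u (insert (x, y) S) p' q' → Edge u S p' q' := by
  refine ⟨⟨hS.finite.insert _, hxy, ?_⟩, ?_⟩
  · rw [Set.image_insert_eq]
    rintro v (rfl | hv) huv n
    · simp only [Set.mem_insert_iff, not_or]
      exact ⟨hu.aperiodic _ n, fun h => (hy _ h (n + 1)).1 rfl⟩
    · simp only [Set.mem_insert_iff, not_or] at huv ⊢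
      exact ⟨(hy _ hv (n + 1)).2, hS.convex v hv huv.2 n⟩
  · rintro p' q' ⟨y', h1, h2⟩
    rcases h1 with h1 | h1
    · obtain ⟨rfl, rfl⟩ := Prod.mk.inj h1
      rcases h2 with h2 | h2
      · exact (hu.aperiodic _ 0 (Prod.mk.inj h2).2).elim
      · exact ((hy _ (mem_snd_image h2) 1).1 rfl).elim
    · rcases h2 with h2 | h2
      · exact ((hy _ (mem_snd_image h1) 1).2 (Prod.mk.inj h2).2).elim
      · exact ⟨y', h1, h2⟩

/-- `dense` realizes the required type off all orbits meeting the range, so that the insertion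
creates no edge. -/
theorem exists_insert_fst (hS : ConvexPartIso u S) (hr : IsTournament r) (hu : FreelyMoving u)
    {x : T} (hx : x ∉ Prod.fst '' S) :
    ∃ y, OffOrbits u (Prod.snd '' S) y ∧ PartIso r (insert (x, y) S) := by
  have hd : Disjoint (Prod.snd '' {q ∈ S | r x q.1}) (Prod.snd '' {q ∈ S | r q.1 x}) := by
    rw [Set.disjoint_left]
    rintro _ ⟨⟨z, y⟩, ⟨h1, h2⟩, rfl⟩ ⟨⟨z', y'⟩, ⟨h3, h4⟩, e⟩
    obtain rfl : y' = y := e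
    obtain rfl := hS.partIso.left_unique hr h1 h3
    exact hr.asymm _ _ h2 h4
  obtain ⟨y, hA, hB, -, hoff⟩ := hu.dense _ _ (Prod.snd '' S)
    ((hS.finite.subset (Set.sep_subset _ _)).image _)
    ((hS.finite.subset (Set.sep_subset _ _)).image _) (hS.finite.image _) hd
  refine ⟨y, hoff, hS.partIso.insert hr hx (fun h => (hoff y h 0).1 rfl) fun q hq => ?_⟩
  have hne : x ≠ q.1 := fun e => hx ⟨q, hq, e.symm⟩
  constructor
  · intro h
    exact hA _ ⟨q, ⟨hq, h⟩, rfl⟩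
  · intro h
    refine (hr.total _ _ hne).resolve_right fun h' => ?_
    exact hr.asymm _ _ h (hB _ ⟨q, ⟨hq, h'⟩, rfl⟩)

/-- A step `s ↦ z` between two new points can be added to the conjugate of `u` by `S`, provided
the types of `s` and `z` are compatible with the steps that are already there. -/
theorem exists_insert_pair (hS : ConvexPartIso u S) (hr : IsTournament r) (hu : FreelyMoving u)
    {s z : T} (hs : s ∉ Prod.fst '' S) (hz : z ∉ Prod.fst '' S) (hsz : r s z)
    (hcomp : ∀ x x', Edge u S x x' → (r s x ↔ r z x')) :
    ∃ y, ConvexPartIso u (insert (z, u y) (insert (s, y) S)) ∧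
      ∀ p' q', Edge u (insert (z, u y) (insert (s, y) S)) p' q' →
        Edge u S p' q' ∨ p' = s ∧ q' = z := by
  have hns : ∀ q ∈ S, s ≠ q.1 := fun q hq e => hs ⟨q, hq, e.symm⟩
  have hnz : ∀ q ∈ S, z ≠ q.1 := fun q hq e => hz ⟨q, hq, e.symm⟩
  -- The point `y` must copy the type of `s`, and `u y` that of `z`; the latter is pulled back by
  -- `u`. The two demands could clash only along an existing edge, which `hcomp` excludes.
  have hd : Disjoint
      (Prod.snd '' {q ∈ S | r s q.1} ∪ (fun q => u.symm q.2) '' {q ∈ S | r z q.1})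
      (Prod.snd '' {q ∈ S | r q.1 s} ∪ (fun q => u.symm q.2) '' {q ∈ S | r q.1 z}) := by
    rw [Set.disjoint_left]
    rintro _ (⟨⟨x, y⟩, ⟨h1, h2⟩, rfl⟩ | ⟨⟨x, y⟩, ⟨h1, h2⟩, rfl⟩)
      (⟨⟨x', y'⟩, ⟨h3, h4⟩, e⟩ | ⟨⟨x', y'⟩, ⟨h3, h4⟩, e⟩)
    · obtain rfl : y' = y := e
      obtain rfl := hS.partIso.left_unique hr h1 h3
      exact hr.asymm _ _ h2 h4
    · obtain rfl : y' = u y := u.symm_apply_eq.1 e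
      exact hr.asymm _ _ ((hcomp _ _ ⟨y, h1, h3⟩).1 h2) h4
    · obtain rfl : y = u y' := u.symm_apply_eq.1 e.symm
      exact hr.asymm _ _ ((hcomp _ _ ⟨y', h3, h1⟩).2 h2) h4
    · obtain rfl : y' = y := u.symm.injective e
      obtain rfl := hS.partIso.left_unique hr h1 h3
      exact hr.asymm _ _ h2 h4
  have hf : ∀ P : T × T → Prop, {q ∈ S | P q}.Finite := fun P =>
    hS.finite.subset (Set.sep_subset _ _)
  obtain ⟨y, hA, hB, hy, hoff⟩ := hu.dense _ _ (Prod.snd '' S)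
    (((hf _).image _).union ((hf _).image _)) (((hf _).image _).union ((hf _).image _))
    (hS.finite.image _) hd
  have hyS : y ∉ Prod.snd '' S := fun h => (hoff y h 0).1 rfl
  have huyS : u y ∉ Prod.snd '' S := fun h => (hoff _ h 1).1 rfl
  have h1 : PartIso r (insert (s, y) S) := hS.partIso.insert hr hs hyS fun q hq => by
    constructor
    · intro h
      exact hA _ (Or.inl ⟨q, ⟨hq, h⟩, rfl⟩)
    · intro h
      refine (hr.total _ _ (hns q hq)).resolve_right fun h' => ?_
      exact hr.asymm _ _ h (hB _ (Or.inl ⟨q, ⟨hq, h'⟩, rfl⟩))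
  have hzs : z ≠ s := fun e => hr.irrefl s (e ▸ hsz)
  have huy : u y ≠ y := hu.aperiodic y 0
  have h2 : PartIso r (insert (z, u y) (insert (s, y) S)) := by
    refine h1.insert hr ?_ ?_ ?_
    · rw [Set.image_insert_eq]
      exact fun h => h.elim hzs hz
    · rw [Set.image_insert_eq]
      exact fun h => h.elim huy huyS
    · rintro q (rfl | hq)
      -- The arrow `s → z` is matched by `y → u y`, the extra clause of `dense`.
      · exact iff_of_false (hr.asymm _ _ hsz) (hr.asymm _ _ hy)
      · have e : r (u y) q.2 ↔ r y (u.symm q.2) := by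
          rw [← u.map_rel_iff (a := y), u.apply_symm_apply]
        have e' : r q.2 (u y) ↔ r (u.symm q.2) y := by
          rw [← u.map_rel_iff (a := u.symm q.2), u.apply_symm_apply]
        constructor
        · intro h
          exact e.2 (hA _ (Or.inr ⟨q, ⟨hq, h⟩, rfl⟩))
        · intro h
          refine (hr.total _ _ (hnz q hq)).resolve_right fun h' => ?_
          exact hr.asymm _ _ h (e'.2 (hB _ (Or.inr ⟨q, ⟨hq, h'⟩, rfl⟩)))
  obtain ⟨c1, e1⟩ := hS.insert_offOrbits hu hoff h1
  obtain ⟨c2, e2⟩ := c1.insert_next hr hu (Set.mem_insert _ _)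
    (by rw [Set.image_insert_eq]; exact fun h => h.elim huy huyS) h2
  exact ⟨y, c2, fun p' q' h => (e2 p' q' h).imp_left (e1 p' q')⟩

end ConvexPartIso

end

/-! ### Three conjugates whose twisted product is trivial -/

section

variable {T : Type*} {r : T → T → Prop}

/-- Each step of the first conjugate is continued by steps of the second and the third one, and the
resulting twisted cycle closes up. -/
def Loops (u h₀ h₁ h₂ : r ≃r r) (S₀ S₁ S₂ : Set (T × T)) : Prop :=
  ∀ p q, Edge u S₀ p q → ∃ q' q'', Edge u S₁ (h₁ q) q' ∧ Edge u S₂ (h₂ q') q'' ∧ h₀ q'' = p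

/-- Old edges persist under extension, so only new edges of the first relation need a loop. -/
theorem Loops.mono {u h₀ h₁ h₂ : r ≃r r} {S₀ S₁ S₂ S₀' S₁' S₂' : Set (T × T)}
    (h : Loops u h₀ h₁ h₂ S₀ S₁ S₂) (h1 : S₁ ⊆ S₁') (h2 : S₂ ⊆ S₂')
    (h' : ∀ p q, Edge u S₀' p q → Edge u S₀ p q ∨ ∃ q' q'',
      Edge u S₁' (h₁ q) q' ∧ Edge u S₂' (h₂ q') q'' ∧ h₀ q'' = p) :
    Loops u h₀ h₁ h₂ S₀' S₁' S₂' := by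
  intro p q hpq
  rcases h' p q hpq with hpq | hpq
  · obtain ⟨q', q'', e1, e2, e3⟩ := h p q hpq
    exact ⟨q', q'', e1.mono h1, e2.mono h2, e3⟩
  · exact hpq

/-- Three finite partial isomorphisms such that all steps of the conjugates of `u` by them are
arranged in closed twisted cycles. -/
structure LoopTriple (u h₀ h₁ h₂ : r ≃r r) (S₀ S₁ S₂ : Set (T × T)) : Prop where
  conv₀ : ConvexPartIso u S₀
  conv₁ : ConvexPartIso u S₁
  conv₂ : ConvexPartIso u S₂
  loops₀ : Loops u h₀ h₁ h₂ S₀ S₁ S₂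
  loops₁ : Loops u h₁ h₂ h₀ S₁ S₂ S₀
  loops₂ : Loops u h₂ h₀ h₁ S₂ S₀ S₁

namespace LoopTriple

variable {u h₀ h₁ h₂ : r ≃r r} {S₀ S₁ S₂ : Set (T × T)}

theorem rotate (h : LoopTriple u h₀ h₁ h₂ S₀ S₁ S₂) : LoopTriple u h₁ h₂ h₀ S₁ S₂ S₀ :=
  ⟨h.conv₁, h.conv₂, h.conv₀, h.loops₁, h.loops₂, h.loops₀⟩

theorem empty : LoopTriple u h₀ h₁ h₂ ∅ ∅ ∅ := by
  refine ⟨.empty, .empty, .empty, ?_, ?_, ?_⟩ <;> rintro p q ⟨_, h, _⟩ <;> exact h.elim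

/-- Replacing the first partial isomorphism by one without further steps. -/
theorem replace (h : LoopTriple u h₀ h₁ h₂ S₀ S₁ S₂) {S : Set (T × T)} (hS : ConvexPartIso u S)
    (hsub : S₀ ⊆ S) (hE : ∀ p q, Edge u S p q → Edge u S₀ p q) :
    LoopTriple u h₀ h₁ h₂ S S₁ S₂ :=
  ⟨hS, h.conv₁, h.conv₂, h.loops₀.mono le_rfl le_rfl fun p q hpq => Or.inl (hE p q hpq),
    h.loops₁.mono le_rfl hsub fun _ _ => Or.inl, h.loops₂.mono hsub le_rfl fun _ _ => Or.inl⟩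

theorem exists_mem_dom (h : LoopTriple u h₀ h₁ h₂ S₀ S₁ S₂) (hr : IsTournament r)
    (hu : FreelyMoving u) (x : T) :
    ∃ S, S₀ ⊆ S ∧ LoopTriple u h₀ h₁ h₂ S S₁ S₂ ∧ ∃ y, (x, y) ∈ S := by
  by_cases hx : x ∈ Prod.fst '' S₀
  · obtain ⟨⟨x, y⟩, hxy, rfl⟩ := hx
    exact ⟨S₀, le_rfl, h, y, hxy⟩
  · obtain ⟨y, hoff, hy⟩ := h.conv₀.exists_insert_fst hr hu hx
    obtain ⟨c, e⟩ := h.conv₀.insert_offOrbits hu hoff hy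
    exact ⟨_, Set.subset_insert _ _, h.replace c (Set.subset_insert _ _) e, y, Set.mem_insert _ _⟩

/-- The cycle through `p` can be completed if both steps adjacent to it are forced. -/
theorem exists_edge_of_mem_of_mem (h : LoopTriple u h₀ h₁ h₂ S₀ S₁ S₂) (hr : IsRandomTournament r)
    (hu : FreelyMoving u) {p y v : T} (hp : (p, y) ∈ S₀) (hq : (h₀.symm p, u v) ∈ S₂) :
    ∃ S₀' S₁' S₂', S₀ ⊆ S₀' ∧ S₁ ⊆ S₁' ∧ S₂ ⊆ S₂' ∧ LoopTriple u h₀ h₁ h₂ S₀' S₁' S₂' ∧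
      ∃ q, Edge u S₀' p q := by
  have ht := hr.toIsTournament
  by_cases huy : u y ∈ Prod.snd '' S₀
  · obtain ⟨⟨q, _⟩, hq, rfl⟩ := huy
    exact ⟨S₀, S₁, S₂, le_rfl, le_rfl, le_rfl, h, q, y, hp, hq⟩
  -- Otherwise an `S₂`-edge would already end at `h₀⁻¹ p`; its loop continues with an `S₀`-edge from
  -- `p`, which puts `u y` in the range.
  have hv : v ∉ Prod.snd '' S₂ := by
    rintro ⟨⟨x, _⟩, hx, rfl⟩
    obtain ⟨q', q'', ⟨y', e1, e2⟩, -, -⟩ := h.loops₂ _ _ ⟨_, hx, hq⟩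
    rw [h₀.apply_symm_apply] at e1
    obtain rfl := h.conv₀.partIso.right_unique ht hp e1
    exact huy (mem_snd_image e2)
  -- Here `h₁ w` must be new for `S₁`, and `h₂ (h₁ w)` new for `S₂`, so that an arrow from it to
  -- `w'` can be imposed next. That arrow becomes `hsz`.
  obtain ⟨w, hwF, hwS, -, hw⟩ := hr.exists_insert_left h.conv₀.partIso h.conv₀.finite huy
    (F := h₁ ⁻¹' (Prod.fst '' S₁) ∪ (fun x => h₂ (h₁ x)) ⁻¹' (Prod.fst '' S₂))
    (((h.conv₁.finite.image _).preimage h₁.injective.injOn).union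
      ((h.conv₂.finite.image _).preimage (h₂.injective.comp h₁.injective).injOn))
    Set.finite_empty (Set.empty_disjoint _)
  simp only [Set.mem_union, Set.mem_preimage, not_or] at hwF
  obtain ⟨w', hwF', hwS', hww', hw'⟩ := hr.exists_insert_left h.conv₂.partIso h.conv₂.finite hv
    (F := h₂.symm ⁻¹' (Prod.fst '' S₁)) ((h.conv₁.finite.image _).preimage h₂.symm.injective.injOn)
    (Set.finite_singleton (h₂ (h₁ w))) (Set.disjoint_singleton_left.2 hwF.2)
  have hsz : r (h₁ w) (h₂.symm w') := by
    rw [← h₂.map_rel_iff, h₂.apply_symm_apply]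
    exact hww' _ rfl
  -- Compare the cycle under construction with the old one through `x → x'`: the relation is carried
  -- around the other two steps and the twists, all of which preserve arrows.
  have hcomp : ∀ x x', Edge u S₁ x x' → (r (h₁ w) x ↔ r (h₂.symm w') x') := by
    intro x x' hx
    obtain ⟨q', q'', ⟨v₁, e1, e1'⟩, ⟨y₁, e2, e2'⟩, rfl⟩ := h.loops₁ _ _ hx
    calc r (h₁ w) (h₁ q'') ↔ r w q'' := h₁.map_rel_iff
      _ ↔ r (u y) (u y₁) := hw.rel_iff (Set.mem_insert _ _) (Set.mem_insert_of_mem _ e2')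
      _ ↔ r y y₁ := u.map_rel_iff
      _ ↔ r p (h₀ q') := (h.conv₀.partIso.rel_iff hp e2).symm
      _ ↔ r (h₀.symm p) q' := by
        rw [← h₀.map_rel_iff (a := h₀.symm p), h₀.apply_symm_apply]
      _ ↔ r (u v) (u v₁) := h.conv₂.partIso.rel_iff hq e1'
      _ ↔ r v v₁ := u.map_rel_iff
      _ ↔ r w' (h₂ x') :=
        (hw'.rel_iff (Set.mem_insert _ _) (Set.mem_insert_of_mem _ e1)).symm
      _ ↔ r (h₂.symm w') x' := by
        rw [← h₂.map_rel_iff (a := h₂.symm w'), h₂.apply_symm_apply]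
  obtain ⟨c₀, e₀⟩ := h.conv₀.insert_next ht hu hp huy hw
  obtain ⟨c₂, e₂⟩ := h.conv₂.insert_prev ht hu hq hv hw'
  obtain ⟨z, c₁, e₁⟩ := h.conv₁.exists_insert_pair ht hu hwF.1 hwF' hsz hcomp
  have s₀ : S₀ ⊆ insert (w, u y) S₀ := Set.subset_insert _ _
  have s₂ : S₂ ⊆ insert (w', v) S₂ := Set.subset_insert _ _
  have s₁ : S₁ ⊆ insert (h₂.symm w', u z) (insert (h₁ w, z) S₁) :=
    (Set.subset_insert _ _).trans (Set.subset_insert _ _)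
  have n₀ : Edge u (insert (w, u y) S₀) p w := ⟨y, s₀ hp, Set.mem_insert _ _⟩
  have n₁ : Edge u (insert (h₂.symm w', u z) (insert (h₁ w, z) S₁)) (h₁ w) (h₂.symm w') :=
    ⟨z, Set.mem_insert_of_mem _ (Set.mem_insert _ _), Set.mem_insert _ _⟩
  have n₂ : Edge u (insert (w', v) S₂) w' (h₀.symm p) := ⟨v, Set.mem_insert _ _, s₂ hq⟩
  refine ⟨_, _, _, s₀, s₁, s₂, ⟨c₀, c₁, c₂, ?_, ?_, ?_⟩, w, n₀⟩
  · refine h.loops₀.mono s₁ s₂ fun p' q' hpq => (e₀ p' q' hpq).imp_right ?_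
    rintro ⟨rfl, rfl⟩
    exact ⟨_, _, n₁, by rwa [h₂.apply_symm_apply], h₀.apply_symm_apply _⟩
  · refine h.loops₁.mono s₂ s₀ fun p' q' hpq => (e₁ p' q' hpq).imp_right ?_
    rintro ⟨rfl, rfl⟩
    exact ⟨h₀.symm p, w, by rwa [h₂.apply_symm_apply], by rwa [h₀.apply_symm_apply], rfl⟩
  · refine h.loops₂.mono s₀ s₁ fun p' q' hpq => (e₂ p' q' hpq).imp_right ?_
    rintro ⟨rfl, rfl⟩
    exact ⟨w, _, by rwa [h₀.apply_symm_apply], n₁, h₂.apply_symm_apply _⟩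

theorem exists_edge (h : LoopTriple u h₀ h₁ h₂ S₀ S₁ S₂) (hr : IsRandomTournament r)
    (hu : FreelyMoving u) (p : T) :
    ∃ S₀' S₁' S₂', S₀ ⊆ S₀' ∧ S₁ ⊆ S₁' ∧ S₂ ⊆ S₂' ∧ LoopTriple u h₀ h₁ h₂ S₀' S₁' S₂' ∧
      ∃ q, Edge u S₀' p q := by
  obtain ⟨S₀', s₀, h', y, hy⟩ := h.exists_mem_dom hr.toIsTournament hu p
  obtain ⟨S₂', s₂, h'', v, hv⟩ := h'.rotate.rotate.exists_mem_dom hr.toIsTournament hu (h₀.symm p)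
  rw [← u.apply_symm_apply v] at hv
  obtain ⟨S₀'', S₁'', S₂'', t₀, t₁, t₂, h₃, hE⟩ := h''.rotate.exists_edge_of_mem_of_mem hr hu hy hv
  exact ⟨_, _, _, s₀.trans t₀, t₁, s₂.trans t₂, h₃, hE⟩

/-- The loop of an `S₁`-edge starting at `h₁ q` contains an `S₀`-edge ending at `q`. -/
theorem exists_edge_to (h : LoopTriple u h₀ h₁ h₂ S₀ S₁ S₂) (hr : IsRandomTournament r)
    (hu : FreelyMoving u) (q : T) :
    ∃ S₀' S₁' S₂', S₀ ⊆ S₀' ∧ S₁ ⊆ S₁' ∧ S₂ ⊆ S₂' ∧ LoopTriple u h₀ h₁ h₂ S₀' S₁' S₂' ∧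
      ∃ p, Edge u S₀' p q := by
  obtain ⟨S₁', S₂', S₀', s₁, s₂, s₀, h', q', hE⟩ := h.rotate.exists_edge hr hu (h₁ q)
  obtain ⟨x, x', -, hE', e⟩ := h'.loops₀ _ _ hE
  obtain rfl := h₁.injective e
  exact ⟨_, _, _, s₀, s₁, s₂, h'.rotate.rotate, _, hE'⟩

theorem exists_iterate_mem_ran (h : LoopTriple u h₀ h₁ h₂ S₀ S₁ S₂) (hr : IsRandomTournament r)
    (hu : FreelyMoving u) {y : T} (hy : y ∈ Prod.snd '' S₀) (n : ℕ) :
    ∃ S₀' S₁' S₂', S₀ ⊆ S₀' ∧ S₁ ⊆ S₁' ∧ S₂ ⊆ S₂' ∧ LoopTriple u h₀ h₁ h₂ S₀' S₁' S₂' ∧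
      u^[n] y ∈ Prod.snd '' S₀' := by
  induction n with
  | zero => exact ⟨S₀, S₁, S₂, le_rfl, le_rfl, le_rfl, h, hy⟩
  | succ n ih =>
    obtain ⟨S₀', S₁', S₂', s₀, s₁, s₂, h', ⟨⟨x, _⟩, hx, rfl⟩⟩ := ih
    obtain ⟨S₀'', S₁'', S₂'', t₀, t₁, t₂, h'', q, z, hz, hq⟩ := h'.exists_edge hr hu x
    refine ⟨_, _, _, s₀.trans t₀, s₁.trans t₁, s₂.trans t₂, h'', ?_⟩
    obtain rfl := h''.conv₀.partIso.right_unique hr.toIsTournament hz (t₀ hx)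
    rw [Function.iterate_succ_apply']
    exact mem_snd_image hq

theorem exists_mem_ran_of_iterate (h : LoopTriple u h₀ h₁ h₂ S₀ S₁ S₂) (hr : IsRandomTournament r)
    (hu : FreelyMoving u) (n : ℕ) {y : T} (hy : u^[n] y ∈ Prod.snd '' S₀) :
    ∃ S₀' S₁' S₂', S₀ ⊆ S₀' ∧ S₁ ⊆ S₁' ∧ S₂ ⊆ S₂' ∧ LoopTriple u h₀ h₁ h₂ S₀' S₁' S₂' ∧
      y ∈ Prod.snd '' S₀' := by
  induction n generalizing y with
  | zero => exact ⟨S₀, S₁, S₂, le_rfl, le_rfl, le_rfl, h, hy⟩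
  | succ n ih =>
    obtain ⟨S₀', S₁', S₂', s₀, s₁, s₂, h', ⟨⟨x, _⟩, hx, hxy⟩⟩ := ih hy
    obtain ⟨S₀'', S₁'', S₂'', t₀, t₁, t₂, h'', p, z, hp, hz⟩ := h'.exists_edge_to hr hu x
    refine ⟨_, _, _, s₀.trans t₀, s₁.trans t₁, s₂.trans t₂, h'', ?_⟩
    have e := h''.conv₀.partIso.right_unique hr.toIsTournament hz (t₀ hx)
    obtain rfl := u.injective (e.trans hxy)
    exact mem_snd_image hp

/-- Off the orbits meeting the range, any preimage creates no edge. On such an orbit convexity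
forbids jumping to `y`, so it is reached one edge at a time. -/
theorem exists_mem_ran (h : LoopTriple u h₀ h₁ h₂ S₀ S₁ S₂) (hr : IsRandomTournament r)
    (hu : FreelyMoving u) (y : T) :
    ∃ S₀' S₁' S₂', S₀ ⊆ S₀' ∧ S₁ ⊆ S₁' ∧ S₂ ⊆ S₂' ∧ LoopTriple u h₀ h₁ h₂ S₀' S₁' S₂' ∧
      y ∈ Prod.snd '' S₀' := by
  by_cases hoff : OffOrbits u (Prod.snd '' S₀) y
  · have hy : y ∉ Prod.snd '' S₀ := fun hy => (hoff y hy 0).1 rfl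
    obtain ⟨x, -, -, -, hx⟩ := hr.exists_insert_left h.conv₀.partIso h.conv₀.finite hy
      Set.finite_empty Set.finite_empty (Set.empty_disjoint _)
    obtain ⟨c, e⟩ := h.conv₀.insert_offOrbits hu hoff hx
    exact ⟨_, _, _, Set.subset_insert _ _, le_rfl, le_rfl, h.replace c (Set.subset_insert _ _) e,
      mem_snd_image (Set.mem_insert _ _)⟩
  · simp only [OffOrbits, not_forall, not_and_or, not_not] at hoff
    obtain ⟨f, hf, n, hn | hn⟩ := hoff
    · exact h.exists_mem_ran_of_iterate hr hu n (hn ▸ hf)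
    · exact hn ▸ h.exists_iterate_mem_ran hr hu hf n

/-- Everything required about the point `x` with respect to the first partial isomorphism. -/
theorem exists_complete (h : LoopTriple u h₀ h₁ h₂ S₀ S₁ S₂) (hr : IsRandomTournament r)
    (hu : FreelyMoving u) (x : T) :
    ∃ S₀' S₁' S₂', S₀ ⊆ S₀' ∧ S₁ ⊆ S₁' ∧ S₂ ⊆ S₂' ∧ LoopTriple u h₀ h₁ h₂ S₀' S₁' S₂' ∧
      x ∈ Prod.snd '' S₀' ∧ ∃ q, Edge u S₀' x q := by
  obtain ⟨S₀', S₁', S₂', s₀, s₁, s₂, h', hx⟩ := h.exists_mem_ran hr hu x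
  obtain ⟨S₀'', S₁'', S₂'', t₀, t₁, t₂, h'', hE⟩ := h'.exists_edge hr hu x
  exact ⟨_, _, _, s₀.trans t₀, s₁.trans t₁, s₂.trans t₂, h'', Set.image_mono t₀ hx, hE⟩

theorem exists_complete_all (h : LoopTriple u h₀ h₁ h₂ S₀ S₁ S₂) (hr : IsRandomTournament r)
    (hu : FreelyMoving u) (x : T) :
    ∃ S₀' S₁' S₂', S₀ ⊆ S₀' ∧ S₁ ⊆ S₁' ∧ S₂ ⊆ S₂' ∧ LoopTriple u h₀ h₁ h₂ S₀' S₁' S₂' ∧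
      (x ∈ Prod.snd '' S₀' ∧ ∃ q, Edge u S₀' x q) ∧ (x ∈ Prod.snd '' S₁' ∧ ∃ q, Edge u S₁' x q) ∧
      (x ∈ Prod.snd '' S₂' ∧ ∃ q, Edge u S₂' x q) := by
  have mono : ∀ {S S' : Set (T × T)}, S ⊆ S' → (x ∈ Prod.snd '' S ∧ ∃ q, Edge u S x q) →
      x ∈ Prod.snd '' S' ∧ ∃ q, Edge u S' x q :=
    fun s h => ⟨Set.image_mono s h.1, h.2.imp fun _ hq => hq.mono s⟩
  obtain ⟨A₀, A₁, A₂, a₀, a₁, a₂, ha, hx₀⟩ := h.exists_complete hr hu x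
  obtain ⟨B₁, B₂, B₀, b₁, b₂, b₀, hb, hx₁⟩ := ha.rotate.exists_complete hr hu x
  obtain ⟨C₂, C₀, C₁, c₂, c₀, c₁, hc, hx₂⟩ := hb.rotate.exists_complete hr hu x
  exact ⟨C₀, C₁, C₂, a₀.trans (b₀.trans c₀), a₁.trans (b₁.trans c₁), a₂.trans (b₂.trans c₂),
    hc.rotate, mono (b₀.trans c₀) hx₀, mono c₁ hx₁, hx₂⟩

end LoopTriple

/-- Every automorphism of the random tournament is a product of three conjugates of `u`. -/
theorem FreelyMoving.exists_conj_mul {u : r ≃r r} (hu : FreelyMoving u)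
    (hr : IsRandomTournament r) (h : r ≃r r) :
    ∃ a b c : r ≃r r, (a⁻¹ * u * a) * (b⁻¹ * u * b) * (c⁻¹ * u * c) = h := by
  have := hr.countable
  let _ := Encodable.ofCountable T
  -- With twists `h⁻¹, 1, 1`, closed loops say that `h⁻¹` times the product of the three conjugates
  -- is the identity.
  let P := {S : Set (T × T) × Set (T × T) × Set (T × T) // LoopTriple u h⁻¹ 1 1 S.1 S.2.1 S.2.2}
  let D : T → Order.Cofinal P := fun x =>
    { carrier := {S | (x ∈ Prod.snd '' S.1.1 ∧ ∃ q, Edge u S.1.1 x q) ∧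
        (x ∈ Prod.snd '' S.1.2.1 ∧ ∃ q, Edge u S.1.2.1 x q) ∧
        (x ∈ Prod.snd '' S.1.2.2 ∧ ∃ q, Edge u S.1.2.2 x q)}
      isCofinal := fun S => by
        obtain ⟨S₀, S₁, S₂, s₀, s₁, s₂, h', hx⟩ := S.2.exists_complete_all hr hu x
        exact ⟨⟨⟨S₀, S₁, S₂⟩, h'⟩, hx, s₀, s₁, s₂⟩ }
  let I := Order.idealOfCofinals (⟨⟨∅, ∅, ∅⟩, LoopTriple.empty⟩ : P) D
  have hI : ∀ x, ∃ S : P, S ∈ D x ∧ S ∈ I := Order.cofinal_meets_idealOfCofinals _ D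
  have key : ∀ f : P → Set (T × T), Monotone f → (∀ S, PartIso r (f S)) →
      (∀ x, ∀ S ∈ D x, x ∈ Prod.snd '' f S ∧ ∃ q, Edge u (f S) x q) →
      ∃ a : r ≃r r, ∀ S ∈ I, ∀ p q, Edge u (f S) p q → (a⁻¹ * u * a) p = q := by
    intro f hf hiso hD
    obtain ⟨a, ha⟩ := hr.toIsTournament.exists_relIso (S := {p | ∃ S ∈ I, p ∈ f S}) (by
        rintro p ⟨S, hS, hp⟩ q ⟨S', hS', hq⟩
        obtain ⟨S'', -, h1, h2⟩ := I.directed _ hS _ hS'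
        exact hiso S'' _ (hf h1 hp) _ (hf h2 hq))
      (fun x => by
        obtain ⟨S, hx, hS⟩ := hI x
        obtain ⟨-, q, y, hy, -⟩ := hD x S hx
        exact ⟨y, S, hS, hy⟩)
      (fun y => by
        obtain ⟨S, hy, hS⟩ := hI y
        obtain ⟨⟨x, _⟩, hx, rfl⟩ := (hD y S hy).1
        exact ⟨x, S, hS, hx⟩)
    refine ⟨a, ?_⟩
    rintro S hS p q ⟨y, h1, h2⟩
    have e1 := ha p y ⟨S, hS, h1⟩
    have e2 := ha q (u y) ⟨S, hS, h2⟩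
    rw [RelIso.mul_apply, RelIso.mul_apply, e1, ← e2, RelIso.inv_apply_self]
  obtain ⟨a, ha⟩ := key (fun S => S.1.1) (fun _ _ h => h.1) (fun S => S.2.conv₀.partIso)
    fun x S hx => hx.1
  obtain ⟨b, hb⟩ := key (fun S => S.1.2.1) (fun _ _ h => h.2.1) (fun S => S.2.conv₁.partIso)
    fun x S hx => hx.2.1
  obtain ⟨c, hc⟩ := key (fun S => S.1.2.2) (fun _ _ h => h.2.2) (fun S => S.2.conv₂.partIso)
    fun x S hx => hx.2.2
  -- The first step of a loop acts first, so it is the rightmost factor.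
  refine ⟨c, b, a, RelIso.ext fun x => ?_⟩
  obtain ⟨S, hx, hS⟩ := hI x
  obtain ⟨q, hq⟩ := hx.1.2
  obtain ⟨q', q'', h1, h2, h3⟩ := S.2.loops₀ x q hq
  rw [RelIso.mul_apply, RelIso.mul_apply, ha S hS _ _ hq, hb S hS q q' h1, hc S hS q' q'' h2, ← h3,
    RelIso.apply_inv_self]

end

/-! ### A product of two conjugates with infinite orbits -/

section

open Relation

variable {T : Type*} {r : T → T → Prop}

/-- The part of `g * (b * g * b⁻¹)` that is determined by the part `S` of the graph of `b`. -/
def Step (g : T → T) (S : Set (T × T)) (x x' : T) : Prop :=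
  ∃ d z, (d, x) ∈ S ∧ (g d, z) ∈ S ∧ g z = x'

theorem Step.mono {g : T → T} {S S' : Set (T × T)} (h : S ⊆ S') {x x' : T} (hx : Step g S x x') :
    Step g S' x x' :=
  let ⟨d, z, h1, h2, h3⟩ := hx
  ⟨d, z, h h1, h h2, h3⟩

/-- `S'` extends `S` without connecting points of the range of `S` by new chains of steps. -/
def StepExtends (g : T → T) (S S' : Set (T × T)) : Prop :=
  S ⊆ S' ∧ ∀ x ∈ Prod.snd '' S, ∀ x' ∈ Prod.snd '' S,
    TransGen (Step g S') x x' → TransGen (Step g S) x x'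

/-- Every new step ends at `g z`, which is a dead end, and no step enters `z`. Hence no chain
between other points can use a new step. -/
theorem Step.insert_of_fresh_snd {g : r ≃r r} (hg : ∀ a, g a ≠ a) {S : Set (T × T)} {d z : T}
    (h0 : z ∉ Prod.snd '' S) (h1 : g z ∉ Prod.snd '' S) (h2 : g.symm z ∉ Prod.snd '' S)
    (hac : ∀ x, ¬ TransGen (Step g S) x x) :
    StepExtends g S (insert (d, z) S) ∧ ∀ x, ¬ TransGen (Step g (insert (d, z) S)) x x := by
  have hin : ∀ x, ¬ Step g (insert (d, z) S) x z := by
    rintro x ⟨d', z', -, h | h, e⟩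
    · exact hg z ((Prod.mk.inj h).2 ▸ e)
    · exact h2 (g.symm_apply_eq.2 e.symm ▸ mem_snd_image h)
  have hout : ∀ x, ¬ Step g (insert (d, z) S) (g z) x := by
    rintro x ⟨d', z', h | h, -, -⟩
    · exact hg z (Prod.mk.inj h).2
    · exact h1 (mem_snd_image h)
  have hstep : ∀ x x', x ≠ z → x' ≠ g z → Step g (insert (d, z) S) x x' → Step g S x x' := by
    rintro x x' hx hx' ⟨d', z', h | h, h' | h', e⟩
    · exact (hx (Prod.mk.inj h).2).elim
    · exact (hx (Prod.mk.inj h).2).elim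
    · exact (hx' ((Prod.mk.inj h').2 ▸ e.symm)).elim
    · exact ⟨d', z', h, h', e⟩
  have hin' : ∀ x x', TransGen (Step g (insert (d, z) S)) x x' → x' ≠ z := by
    rintro x x' (h | ⟨-, h⟩) rfl <;> exact hin _ h
  have hchain : ∀ x x', x ≠ z → TransGen (Step g (insert (d, z) S)) x x' → x' ≠ g z →
      TransGen (Step g S) x x' := by
    intro x x' hx h
    induction h with
    | single h => exact fun hx' => .single (hstep _ _ hx hx' h)
    | tail h h' ih =>
      intro hx'
      refine .tail (ih ?_) (hstep _ _ (hin' _ _ h) hx' h')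
      rintro rfl
      exact hout _ h'
  refine ⟨⟨Set.subset_insert _ _, fun x hx x' hx' h => hchain x x' ?_ h ?_⟩, fun x h => ?_⟩
  · rintro rfl
    exact h0 hx
  · rintro rfl
    exact h1 hx'
  · refine hac x (hchain x x (hin' _ _ h) h ?_)
    rintro rfl
    obtain ⟨_, h, -⟩ := TransGen.head'_iff.1 h
    exact hout _ h

/-- A step needs values at both `d` and `g d`; the neighbours of the new argument under `g` have
none. -/
theorem Step.insert_of_fresh_fst {g : r ≃r r} (hg : ∀ a, g a ≠ a) {S : Set (T × T)} {d z : T}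
    (h1 : g d ∉ Prod.fst '' S) (h2 : g.symm d ∉ Prod.fst '' S) :
    Step g (insert (d, z) S) = Step g S := by
  ext x x'
  refine ⟨?_, Step.mono (Set.subset_insert _ _)⟩
  rintro ⟨d', z', h | h, h' | h', e⟩
  · obtain ⟨rfl, rfl⟩ := Prod.mk.inj h
    exact (hg _ (Prod.mk.inj h').1).elim
  · obtain ⟨rfl, rfl⟩ := Prod.mk.inj h
    exact (h1 (mem_fst_image h')).elim
  · refine (h2 ?_).elim
    rw [← (Prod.mk.inj h').1, g.symm_apply_apply]
    exact mem_fst_image h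
  · exact ⟨d', z', h, h', e⟩

/-- A finite partial isomorphism whose chains of steps do not contain cycles. -/
structure AcyclicPartIso (g : r ≃r r) where
  /-- The graph of the partial isomorphism. -/
  graph : Set (T × T)
  finite : graph.Finite
  partIso : PartIso r graph
  acyclic : ∀ x, ¬ TransGen (Step g graph) x x

namespace AcyclicPartIso

variable {g : r ≃r r}

/-- Inclusion alone would be too weak: under this order, whether a chain joins two points is settled
once both lie in the range, so finite conditions control orbits of the limit. -/
instance : Preorder (AcyclicPartIso g) where
  le S S' := StepExtends g S.graph S'.graph
  le_refl S := ⟨le_rfl, fun _ _ _ _ h => h⟩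
  le_trans S S' S'' h h' := ⟨h.1.trans h'.1, fun x hx x' hx' e =>
    h.2 x hx x' hx' (h'.2 x (Set.image_mono h.1 hx) x' (Set.image_mono h.1 hx') e)⟩

theorem graph_mono {S S' : AcyclicPartIso g} (h : S ≤ S') : S.graph ⊆ S'.graph := h.1

/-- The empty partial isomorphism. -/
def empty (g : r ≃r r) : AcyclicPartIso g where
  graph := ∅
  finite := Set.finite_empty
  partIso := PartIso.empty
  acyclic x h := by
    obtain ⟨_, ⟨_, _, h, _⟩, -⟩ := TransGen.head'_iff.1 h
    exact h.elim

theorem exists_insert_snd (S : AcyclicPartIso g) (hr : IsRandomTournament r) (hg : ∀ a, r a (g a))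
    {d : T} (hd : d ∉ Prod.fst '' S.graph) {C : Set T} (hC : C.Finite)
    (hCS : Disjoint C (Prod.snd '' S.graph)) :
    ∃ S' z, S ≤ S' ∧ S'.graph = insert (d, z) S.graph ∧ ∀ c ∈ C, r c z := by
  have hfin := S.finite.image Prod.snd
  obtain ⟨z, hz, hzS, hzC, hi⟩ := hr.exists_insert_right S.partIso S.finite hd
    (F := g ⁻¹' (Prod.snd '' S.graph) ∪ g.symm ⁻¹' (Prod.snd '' S.graph))
    ((hfin.preimage g.injective.injOn).union (hfin.preimage g.symm.injective.injOn)) hC hCS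
  simp only [Set.mem_union, Set.mem_preimage, not_or] at hz
  obtain ⟨h, hac⟩ := Step.insert_of_fresh_snd (d := d)
    (fun a e => hr.irrefl a (by simpa [e] using hg a)) hzS hz.1 hz.2 S.acyclic
  exact ⟨⟨_, S.finite.insert _, hi, hac⟩, z, h, rfl, hzC⟩

theorem exists_insert_fst (S : AcyclicPartIso g) (hr : IsRandomTournament r) (hg : ∀ a, r a (g a))
    {z : T} (hz : z ∉ Prod.snd '' S.graph) :
    ∃ S' d, S ≤ S' ∧ S'.graph = insert (d, z) S.graph ∧ g d ∉ Prod.fst '' S'.graph ∧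
      Step g S'.graph = Step g S.graph := by
  have hg' : ∀ a, g a ≠ a := fun a e => hr.irrefl a (by simpa [e] using hg a)
  have hfin := S.finite.image Prod.fst
  obtain ⟨d, hd, hdS, -, hi⟩ := hr.exists_insert_left S.partIso S.finite hz
    (F := g ⁻¹' (Prod.fst '' S.graph) ∪ g.symm ⁻¹' (Prod.fst '' S.graph))
    ((hfin.preimage g.injective.injOn).union (hfin.preimage g.symm.injective.injOn))
    Set.finite_empty (Set.empty_disjoint _)
  simp only [Set.mem_union, Set.mem_preimage, not_or] at hd
  have e : Step g (insert (d, z) S.graph) = Step g S.graph :=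
    Step.insert_of_fresh_fst hg' hd.1 hd.2
  refine ⟨⟨_, S.finite.insert _, hi, e ▸ S.acyclic⟩, d, ⟨Set.subset_insert _ _, ?_⟩, rfl, ?_, e⟩
  · intro x _ x' _ h
    exact e ▸ h
  · rw [Set.image_insert_eq]
    exact fun h => h.elim (hg' d) hd.1

theorem exists_mem_fst_snd (S : AcyclicPartIso g) (hr : IsRandomTournament r)
    (hg : ∀ a, r a (g a)) (x : T) :
    ∃ S', S ≤ S' ∧ x ∈ Prod.fst '' S'.graph ∧ x ∈ Prod.snd '' S'.graph := by
  obtain ⟨S', h', hx'⟩ : ∃ S', S ≤ S' ∧ x ∈ Prod.fst '' S'.graph := by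
    by_cases hx : x ∈ Prod.fst '' S.graph
    · exact ⟨S, le_rfl, hx⟩
    · obtain ⟨S', z, h, e, -⟩ := S.exists_insert_snd hr hg hx Set.finite_empty (Set.empty_disjoint _)
      exact ⟨S', h, e ▸ mem_fst_image (Set.mem_insert _ _)⟩
  by_cases hx : x ∈ Prod.snd '' S'.graph
  · exact ⟨S', h', hx', hx⟩
  · obtain ⟨S'', d, h, e, -⟩ := S'.exists_insert_fst hr hg hx
    exact ⟨S'', h'.trans h, Set.image_mono (graph_mono h) hx',
      e ▸ mem_snd_image (Set.mem_insert _ _)⟩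

theorem exists_subset_fst_snd (S : AcyclicPartIso g) (hr : IsRandomTournament r)
    (hg : ∀ a, r a (g a)) {F : Set T} (hF : F.Finite) :
    ∃ S', S ≤ S' ∧ F ⊆ Prod.fst '' S'.graph ∧ F ⊆ Prod.snd '' S'.graph := by
  induction F, hF using Set.Finite.induction_on with
  | empty => exact ⟨S, le_rfl, Set.empty_subset _, Set.empty_subset _⟩
  | insert _ _ ih =>
    obtain ⟨S', h', h1, h2⟩ := ih
    obtain ⟨S'', h'', h3, h4⟩ := S'.exists_mem_fst_snd hr hg _
    exact ⟨S'', h'.trans h'', Set.insert_subset h3 (h1.trans (Set.image_mono (graph_mono h''))),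
      Set.insert_subset h4 (h2.trans (Set.image_mono (graph_mono h'')))⟩

/-- Any type over a finite set is realized by a point which is not connected to finitely many given
points by chains of steps, and from which a step goes forward. -/
theorem exists_generic (S : AcyclicPartIso g) (hr : IsRandomTournament r) (hg : ∀ a, r a (g a))
    {A B F : Set T} (hA : A.Finite) (hB : B.Finite) (hF : F ⊆ Prod.snd '' S.graph)
    (hAB : Disjoint A B) :
    ∃ S' y, S ≤ S' ∧ y ∈ Prod.snd '' S'.graph ∧ (∀ a ∈ A, r y a) ∧ (∀ b ∈ B, r b y) ∧
      (∃ y', Step g S'.graph y y' ∧ r y y') ∧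
      ∀ f ∈ F, y ≠ f ∧ ¬ TransGen (Step g S'.graph) y f ∧ ¬ TransGen (Step g S'.graph) f y := by
  have hg' : ∀ a, g a ≠ a := fun a e => hr.irrefl a (by simpa [e] using hg a)
  have hfin := S.finite.image Prod.snd
  obtain ⟨y, hy, hyA, hyB⟩ := hr.exists_notMem hA hB
    (hfin.union (hfin.preimage g.symm.injective.injOn)) hAB
  simp only [Set.mem_union, Set.mem_preimage, not_or] at hy
  obtain ⟨S₁, d, h₁, e₁, hd, hstep⟩ := S.exists_insert_fst hr hg hy.1
  have hgy : g.symm y ∉ Prod.snd '' S₁.graph := by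
    rw [e₁, Set.image_insert_eq]
    refine fun h => h.elim (fun e => hg' y ?_) hy.2
    exact (g.symm_apply_eq.1 e).symm
  -- Inserting `(g d, z)` makes `y` step to `g z`; the imposed arrow `g⁻¹ y → z` gives `y → g z`.
  obtain ⟨S₂, z, h₂, e₂, hz⟩ := S₁.exists_insert_snd hr hg hd (Set.finite_singleton (g.symm y))
    (Set.disjoint_singleton_left.2 hgy)
  have hdy : (d, y) ∈ S₁.graph := e₁ ▸ Set.mem_insert _ _
  have hF₁ := hF.trans (Set.image_mono (graph_mono h₁))
  refine ⟨S₂, y, h₁.trans h₂, mem_snd_image (graph_mono h₂ hdy), hyA, hyB,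
    ⟨g z, ⟨d, z, graph_mono h₂ hdy, e₂ ▸ Set.mem_insert _ _, rfl⟩, ?_⟩, fun f hf => ⟨?_, ?_, ?_⟩⟩
  · rw [← g.symm.map_rel_iff, g.symm_apply_apply]
    exact hz _ rfl
  · rintro rfl
    exact hy.1 (hF hf)
  · intro h
    have h' := h₂.2 y (mem_snd_image hdy) f (hF₁ hf) h
    rw [hstep] at h'
    obtain ⟨_, ⟨_, _, h', -⟩, -⟩ := TransGen.head'_iff.1 h'
    exact hy.1 (mem_snd_image h')
  · intro h
    have h' := h₂.2 f (hF₁ hf) y (mem_snd_image hdy) h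
    rw [hstep] at h'
    obtain ⟨_, -, ⟨_, z', -, h', e⟩⟩ := TransGen.tail'_iff.1 h'
    exact hy.2 (g.symm_apply_eq.2 e.symm ▸ mem_snd_image h')

end AcyclicPartIso

/-- If `a → g a` for all `a`, then some product of two conjugates of `g` moves freely. -/
theorem IsRandomTournament.exists_freelyMoving (hr : IsRandomTournament r) {g : r ≃r r}
    (hg : ∀ a, r a (g a)) : ∃ b : r ≃r r, FreelyMoving (g * (b * g * b⁻¹)) := by
  have := hr.countable
  let _ := Encodable.ofCountable (Finset T × Finset T × Finset T)
  let D : Finset T × Finset T × Finset T → Order.Cofinal (AcyclicPartIso g) := fun X =>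
    { carrier := {S | ↑X.2.2 ⊆ Prod.fst '' S.graph ∧ ↑X.2.2 ⊆ Prod.snd '' S.graph ∧
        (Disjoint X.1 X.2.1 → ∃ y ∈ Prod.snd '' S.graph, (∀ a ∈ X.1, r y a) ∧
          (∀ b ∈ X.2.1, r b y) ∧ (∃ y', Step g S.graph y y' ∧ r y y') ∧
          ∀ f ∈ X.2.2, y ≠ f ∧ ¬ TransGen (Step g S.graph) y f ∧
            ¬ TransGen (Step g S.graph) f y)}
      isCofinal := fun S => by
        obtain ⟨S₁, h₁, h1, h2⟩ := S.exists_subset_fst_snd hr hg X.2.2.finite_toSet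
        by_cases hd : Disjoint X.1 X.2.1
        · obtain ⟨S₂, y, h₂, hy⟩ := S₁.exists_generic hr hg X.1.finite_toSet X.2.1.finite_toSet h2
            (Finset.disjoint_coe.2 hd)
          exact ⟨S₂, ⟨h1.trans (Set.image_mono (AcyclicPartIso.graph_mono h₂)),
            h2.trans (Set.image_mono (AcyclicPartIso.graph_mono h₂)), fun _ => ⟨y, hy⟩⟩,
            h₁.trans h₂⟩
        · exact ⟨S₁, ⟨h1, h2, fun h => (hd h).elim⟩, h₁⟩ }
  let I := Order.idealOfCofinals (AcyclicPartIso.empty g) D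
  have hI : ∀ X, ∃ S, S ∈ D X ∧ S ∈ I := Order.cofinal_meets_idealOfCofinals _ D
  have hIx : ∀ x, ∃ S ∈ I, x ∈ Prod.fst '' S.graph ∧ x ∈ Prod.snd '' S.graph := by
    intro x
    obtain ⟨S, h, hS⟩ := hI (∅, ∅, {x})
    exact ⟨S, hS, h.1 (by simp), h.2.1 (by simp)⟩
  obtain ⟨b, hb⟩ := hr.toIsTournament.exists_relIso (S := {p | ∃ S ∈ I, p ∈ S.graph}) (by
      rintro p ⟨S, hS, hp⟩ q ⟨S', hS', hq⟩
      obtain ⟨S'', -, h1, h2⟩ := I.directed _ hS _ hS'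
      exact S''.partIso _ (AcyclicPartIso.graph_mono h1 hp) _ (AcyclicPartIso.graph_mono h2 hq))
    (fun x => by
      obtain ⟨S, hS, ⟨⟨_, y⟩, h, rfl⟩, -⟩ := hIx x
      exact ⟨y, S, hS, h⟩)
    (fun x => by
      obtain ⟨S, hS, -, ⟨⟨y, _⟩, h, rfl⟩⟩ := hIx x
      exact ⟨y, S, hS, h⟩)
  have hstep : ∀ S ∈ I, ∀ x x', Step g S.graph x x' → (g * (b * g * b⁻¹)) x = x' := by
    rintro S hS x x' ⟨d, z, h1, h2, rfl⟩
    have e1 := hb d x ⟨S, hS, h1⟩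
    have e2 := hb (g d) z ⟨S, hS, h2⟩
    rw [RelIso.mul_apply, RelIso.mul_apply, RelIso.mul_apply, ← e1, RelIso.inv_apply_self, e2]
  have hexists : ∀ x, ∃ S ∈ I, ∃ x', Step g S.graph x x' := by
    intro x
    obtain ⟨S, hS, -, ⟨⟨d, _⟩, h, rfl⟩⟩ := hIx x
    obtain ⟨S', hS', ⟨⟨_, z⟩, h', e⟩, -⟩ := hIx (g d)
    obtain rfl : _ = g d := e
    obtain ⟨S'', hS'', h1, h2⟩ := I.directed _ hS _ hS'
    exact ⟨S'', hS'', g z, d, z, AcyclicPartIso.graph_mono h1 h, AcyclicPartIso.graph_mono h2 h', rfl⟩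
  refine ⟨b, ?_⟩
  generalize g * (b * g * b⁻¹) = u at hstep ⊢
  have hchain : ∀ x (n : ℕ), ∃ S ∈ I, TransGen (Step g S.graph) x (u^[n] (u x)) := by
    intro x n
    induction n with
    | zero =>
      obtain ⟨S, hS, x', h⟩ := hexists x
      obtain rfl := hstep S hS x x' h
      exact ⟨S, hS, .single h⟩
    | succ n ih =>
      obtain ⟨S, hS, h⟩ := ih
      obtain ⟨S', hS', x', h'⟩ := hexists (u^[n] (u x))
      obtain rfl := hstep S' hS' _ x' h'
      obtain ⟨S'', hS'', h1, h2⟩ := I.directed _ hS _ hS'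
      rw [Function.iterate_succ_apply']
      exact ⟨S'', hS'', .tail (TransGen.mono (fun _ _ => Step.mono (AcyclicPartIso.graph_mono h1)) _ _ h)
        (h'.mono (AcyclicPartIso.graph_mono h2))⟩
  -- A chain found at some later stage is pulled back to `S` through a common upper bound in the
  -- ideal.
  have hreflect : ∀ S ∈ I, ∀ x ∈ Prod.snd '' S.graph, ∀ (n : ℕ),
      u^[n] (u x) ∈ Prod.snd '' S.graph → TransGen (Step g S.graph) x (u^[n] (u x)) := by
    intro S hS x hx n hx'
    obtain ⟨S', hS', h⟩ := hchain x n
    obtain ⟨S'', hS'', h1, h2⟩ := I.directed _ hS _ hS'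
    exact h1.2 x hx _ hx' (TransGen.mono (fun _ _ => Step.mono (AcyclicPartIso.graph_mono h2)) _ _ h)
  refine ⟨fun x n e => ?_, fun A B F hA hB hF hAB => ?_⟩
  · obtain ⟨S, hS, h⟩ := hchain x n
    rw [e] at h
    exact S.acyclic x h
  · obtain ⟨S, ⟨-, hFS, h⟩, hS⟩ := hI (hA.toFinset, hB.toFinset, hF.toFinset)
    obtain ⟨y, hy, hyA, hyB, ⟨y', hyy', hyr⟩, hyF⟩ := h (Set.Finite.disjoint_toFinset.2 hAB)
    simp only [Set.Finite.mem_toFinset, Set.Finite.coe_toFinset] at hyA hyB hyF hFS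
    obtain rfl := hstep S hS y y' hyy'
    refine ⟨y, hyA, hyB, hyr, fun f hf n => ?_⟩
    obtain ⟨h0, h1, h2⟩ := hyF f hf
    cases n with
    | zero => exact ⟨h0, h0.symm⟩
    | succ n =>
      refine ⟨fun e => h1 ?_, fun e => h2 ?_⟩
      · exact e ▸ hreflect S hS y hy n (show u^[n + 1] y ∈ _ from e ▸ hFS hf)
      · exact e ▸ hreflect S hS f (hFS hf) n (show u^[n + 1] f ∈ _ from e ▸ hy)

/-- If `a → g a` for all `a`, then every automorphism is a product of six conjugates of `g`. -/
theorem IsRandomTournament.isProdOfConjugates (hr : IsRandomTournament r) {g : r ≃r r}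
    (hg : ∀ a, r a (g a)) (h : r ≃r r) : IsProdOfConjugates 8 g h := by
  obtain ⟨b, hb⟩ := hr.exists_freelyMoving hg
  obtain ⟨x, y, z, rfl⟩ := hb.exists_conj_mul hr h
  have hc : ∀ c : r ≃r r, IsConj g (c⁻¹ * g * c) := fun c =>
    isConj_iff.2 ⟨c⁻¹, by rw [inv_inv]⟩
  have hc' : ∀ c : r ≃r r, IsConj g (c⁻¹ * (b * g * b⁻¹) * c) := fun c =>
    isConj_iff.2 ⟨c⁻¹ * b, by group⟩
  refine ⟨[x⁻¹ * g * x, x⁻¹ * (b * g * b⁻¹) * x, y⁻¹ * g * y, y⁻¹ * (b * g * b⁻¹) * y,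
    z⁻¹ * g * z, z⁻¹ * (b * g * b⁻¹) * z], by simp, ?_, ?_⟩
  · intro w hw
    simp only [List.mem_cons, List.not_mem_nil, or_false] at hw
    rcases hw with rfl | rfl | rfl | rfl | rfl | rfl
    exacts [.inl (hc x), .inl (hc' x), .inl (hc y), .inl (hc' y), .inl (hc z), .inl (hc' z)]
  · simp only [List.prod_cons, List.prod_nil]
    group

end

/-! ### Unboundedly increasing automorphisms of the rationals -/

theorem unboundedlyIncreasing_of_add_one_le {f : ℚ ≃o ℚ} (hf : ∀ x, x + 1 ≤ f x) :
    UnboundedlyIncreasing f := by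
  have key : ∀ (a : ℚ) (m : ℕ), a + m ≤ (f ^ m) a := by
    intro a m
    induction m with
    | zero => simp
    | succ m ih =>
      rw [pow_succ', RelIso.mul_apply]
      push_cast
      linarith [hf ((f ^ m) a)]
  refine ⟨fun a => by linarith [hf a], fun a b _ => ?_⟩
  obtain ⟨m, hm⟩ := exists_nat_gt (b - a)
  exact ⟨m, by linarith [key a m]⟩

/-- Translation by one. -/
def translationOne : ℚ ≃o ℚ := OrderIso.addRight 1

/-- Conjugating `f` into the translation by one: `[0, 1)` is mapped linearly onto `[0, f 0)`. -/
def fundamentalMap (f : ℚ ≃o ℚ) (x : ℚ) : ℚ := (f ^ ⌊x⌋) (f 0 * Int.fract x)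

namespace UnboundedlyIncreasing

variable {f : ℚ ≃o ℚ}

theorem strictMono_zpow_apply (hf : UnboundedlyIncreasing f) (x : ℚ) :
    StrictMono fun n : ℤ => (f ^ n) x := by
  refine strictMono_int_of_lt_succ fun n => ?_
  rw [add_comm, zpow_one_add, RelIso.mul_apply]
  exact hf.1 _

/-- The iterates of `0` are unbounded in both directions, so their intervals tile the line. -/
theorem exists_zpow_le_lt (hf : UnboundedlyIncreasing f) (y : ℚ) :
    ∃ n : ℤ, (f ^ n) 0 ≤ y ∧ y < (f ^ (n + 1)) 0 := by
  have h1 : ∃ n : ℤ, (f ^ n) 0 ≤ y := by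
    rcases lt_or_ge y 0 with hy | hy
    · obtain ⟨m, hm⟩ := hf.2 y 0 hy
      refine ⟨-m, ?_⟩
      have := (f ^ (-m : ℤ)).monotone hm.le
      rwa [← zpow_natCast, ← RelIso.mul_apply, ← zpow_add, neg_add_cancel, zpow_zero] at this
    · exact ⟨0, by simpa using hy⟩
  have h2 : ∃ b : ℤ, ∀ n : ℤ, (f ^ n) 0 ≤ y → n ≤ b := by
    obtain ⟨b, hb⟩ : ∃ b : ℕ, y < (f ^ b) 0 := by
      rcases lt_or_ge 0 y with hy | hy
      · exact hf.2 0 y hy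
      · exact ⟨1, hy.trans_lt (by simpa using hf.1 0)⟩
    refine ⟨b, fun n hn => ?_⟩
    rw [← zpow_natCast] at hb
    exact ((hf.strictMono_zpow_apply 0).lt_iff_lt.1 (hn.trans_lt hb)).le
  obtain ⟨n, hn, hmax⟩ := Int.exists_greatest_of_bdd h2 h1
  exact ⟨n, hn, lt_of_not_ge fun h => by linarith [hmax _ h]⟩

theorem strictMono_fundamentalMap (hf : UnboundedlyIncreasing f) :
    StrictMono (fundamentalMap f) := by
  have h0 : 0 < f 0 := hf.1 0
  intro x y hxy
  rcases (Int.floor_mono hxy.le).eq_or_lt with h | h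
  · have : Int.fract x < Int.fract y := by
      rw [Int.fract, Int.fract, h]
      linarith
    rw [fundamentalMap, fundamentalMap, h]
    exact (f ^ ⌊y⌋).strictMono (mul_lt_mul_of_pos_left this h0)
  · calc (f ^ ⌊x⌋) (f 0 * Int.fract x) < (f ^ ⌊x⌋) (f 0) :=
          (f ^ ⌊x⌋).strictMono (mul_lt_of_lt_one_right h0 (Int.fract_lt_one x))
      _ = (f ^ (⌊x⌋ + 1)) 0 := by rw [zpow_add_one, RelIso.mul_apply]
      _ ≤ (f ^ ⌊y⌋) 0 := (hf.strictMono_zpow_apply 0).monotone h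
      _ ≤ (f ^ ⌊y⌋) (f 0 * Int.fract y) :=
          (f ^ ⌊y⌋).monotone (mul_nonneg h0.le (Int.fract_nonneg y))

theorem surjective_fundamentalMap (hf : UnboundedlyIncreasing f) :
    Function.Surjective (fundamentalMap f) := by
  have h0 : 0 < f 0 := hf.1 0
  intro y
  obtain ⟨n, h1, h2⟩ := hf.exists_zpow_le_lt y
  obtain ⟨t, rfl⟩ := (f ^ n).surjective y
  rw [(f ^ n).le_iff_le] at h1
  rw [zpow_add_one, RelIso.mul_apply, (f ^ n).lt_iff_lt] at h2
  have hfl : ⌊(n : ℚ) + t / f 0⌋ = n := by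
    rw [Int.floor_intCast_add, Int.floor_eq_zero_iff.2 ⟨by positivity, (div_lt_one h0).2 h2⟩,
      add_zero]
  -- Since `t` lies in `[0, f 0)`, the integer part is `n` and the fractional part is `t / f 0`.
  refine ⟨n + t / f 0, ?_⟩
  rw [fundamentalMap, Int.fract, hfl, add_sub_cancel_left, mul_div_cancel₀ _ h0.ne']

theorem isConj_translationOne (hf : UnboundedlyIncreasing f) : IsConj translationOne f := by
  refine isConj_iff.2
    ⟨hf.strictMono_fundamentalMap.orderIsoOfSurjective _ hf.surjective_fundamentalMap, ?_⟩
  rw [mul_inv_eq_iff_eq_mul]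
  refine RelIso.ext fun x => ?_
  change fundamentalMap f (x + 1) = f (fundamentalMap f x)
  rw [fundamentalMap, fundamentalMap, Int.floor_add_one, Int.fract_add_one, add_comm, zpow_one_add,
    RelIso.mul_apply]

theorem isConj {g : ℚ ≃o ℚ} (hf : UnboundedlyIncreasing f) (hg : UnboundedlyIncreasing g) :
    IsConj f g :=
  hf.isConj_translationOne.symm.trans hg.isConj_translationOne

end UnboundedlyIncreasing

/-- The pointwise maximum of two automorphisms of a linear order. -/
noncomputable def OrderIso.pointwiseMax {α : Type*} [LinearOrder α] (f g : α ≃o α) : α ≃o α :=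
  StrictMono.orderIsoOfSurjective (fun x => max (f x) (g x))
    (fun _ _ h => max_lt_max (f.strictMono h) (g.strictMono h)) fun y => by
      -- The inverse of a maximum of automorphisms is the minimum of their inverses.
      refine ⟨min (f.symm y) (g.symm y), ?_⟩
      rcases le_total (f.symm y) (g.symm y) with h | h
      · simpa [min_eq_left h] using g.le_symm_apply.1 h
      · simpa [min_eq_right h] using f.le_symm_apply.1 h

/-- Every automorphism of the rationals is a product of a conjugate of `g` and one of `g⁻¹`. -/
theorem UnboundedlyIncreasing.isProdOfConjugates {g : ℚ ≃o ℚ} (hg : UnboundedlyIncreasing g)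
    (h : ℚ ≃o ℚ) : IsProdOfConjugates 8 g h := by
  -- The first argument of the maximum makes `h⁻¹ * f` dominate the translation, the second makes
  -- `f` do so.
  let f : ℚ ≃o ℚ := (h * translationOne).pointwiseMax translationOne
  have hf : UnboundedlyIncreasing f :=
    unboundedlyIncreasing_of_add_one_le fun x => le_max_right (h (x + 1)) (x + 1)
  have hk : UnboundedlyIncreasing (h⁻¹ * f) :=
    unboundedlyIncreasing_of_add_one_le fun x =>
      h.le_symm_apply.2 (le_max_left (h (x + 1)) (x + 1))
  refine ⟨[f, (h⁻¹ * f)⁻¹], by simp, ?_, by simp⟩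
  intro x hx
  simp only [List.mem_cons, List.not_mem_nil, or_false] at hx
  rcases hx with rfl | rfl
  · exact Or.inl (hg.isConj hf)
  · obtain ⟨c, hc⟩ := isConj_iff.1 (hg.isConj hk)
    exact Or.inr (isConj_iff.2 ⟨c, by rw [← hc]; group⟩)

theorem mainTheorem5 :
    (∀ g : ℚ ≃o ℚ, UnboundedlyIncreasing g → ∀ h : ℚ ≃o ℚ, IsProdOfConjugates 8 g h) ∧
    (∀ {T : Type*} (r : T → T → Prop), IsRandomTournament r →
      ∀ g : r ≃r r, (∀ a, r a (g a)) → ∀ h : r ≃r r, IsProdOfConjugates 8 g h) :=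
  ⟨fun _ hg h => hg.isProdOfConjugates h, fun _ hr _ hg h => hr.isProdOfConjugates hg h⟩
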